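/- Let $G_1,\dots,G_n$ be groups and let $\Gamma < G_1\times\cdots\times G_n$ be a subgroup of finite index. For each $i$ let $\pi_i:\Gamma\to G_i$ be the restriction to $\Gamma$ of the $i$th projection, let $\Gamma_i:=\pi_i(\Gamma)$ be its image, and regard $\pi_i$ also as a surjective homomorphism $\Gamma\to\Gamma_i$. (1) The rational first cohomology of $\Gamma$ is the internal direct sum of the pulled-back subspaces: \[ H^1(\Gamma;\mathbb{Q})=\bigoplus_{i=1}^n \pi_i^*\bigl(H^1(\Gamma_i;\mathbb{Q})\bigr). \] (2) Let $\Lambda$ be a torsion-free, non-elementary hyperbolic group; that is, $\Lambda$ has a finite generating set whose Cayley graph is $\delta$-hyperbolic (in the sense of Gromov) for some $\delta>0$, no nontrivial element of $\Lambda$ has finite order, and $\Lambda$ is not virtually cyclic. Then for every homomorphism $\phi:\Gamma\to\Lambda$, either there are an index $i$ and a homomorphism $\psi:\Gamma_i\to\Lambda$ with $\phi=\psi\circ\pi_i$, or the image $\phi(\Gamma)$ is a cyclic group. -/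

import Mathlib

universe u v

/-- The Gromov four-point condition for the path metric on the vertices of a graph:
`d(x,y) + d(z,w) ≤ max (d(x,z) + d(y,w)) (d(x,w) + d(y,z)) + 2δ` (the graph is required to be
connected, so that `dist` is a genuine metric). -/
def SimpleGraph.IsGromovHyperbolic {V : Type*} (X : SimpleGraph V) (δ : ℝ) : Prop :=
  X.Connected ∧ ∀ x y z w : V,
    (X.dist x y : ℝ) + X.dist z w ≤
      max ((X.dist x z : ℝ) + X.dist y w) ((X.dist x w : ℝ) + X.dist y z) + 2 * δ

/-- A group is hyperbolic if it has a finite generating set whose Cayley graph is `δ`-hyperbolic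
for some `δ > 0`. -/
def IsHyperbolicGroup (L : Type*) [Group L] : Prop :=
  ∃ S : Set L, S.Finite ∧ Subgroup.closure S = ⊤ ∧
    ∃ δ : ℝ, 0 < δ ∧ (SimpleGraph.mulCayley S).IsGromovHyperbolic δ

/-- A group is elementary if it is virtually cyclic (this includes the finite groups). -/
def IsElementaryGroup (L : Type*) [Group L] : Prop :=
  ∃ C : Subgroup L, IsCyclic C ∧ C.FiniteIndex

/-- No nontrivial element has finite order. (Mathlib's `IsMulTorsionFree` asks for unique roots,
which is a stronger condition on a non-commutative group.) -/
def HasNoTorsion (L : Type*) [Group L] : Prop :=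
  ∀ g : L, g ≠ 1 → ¬ IsOfFinOrder g

/-- The restriction to `Γ` of the `i`th projection of a product of groups. -/
def subProj {n : ℕ} {G : Fin n → Type u} [∀ i, Group (G i)]
    (Γ : Subgroup (∀ i, G i)) (i : Fin n) : Γ →* G i :=
  (Pi.evalMonoidHom G i).comp Γ.subtype

/-- The first cohomology group `H¹(G; ℚ)` with trivial coefficients. As Mathlib's group cohomology
wants the coefficient ring in the universe of the group, `ℚ` is lifted to that universe. -/
noncomputable abbrev rationalH1 (G : Type u) [Group G] : ModuleCat.{u} (ULift.{u} ℚ) :=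
  groupCohomology (Rep.trivial (ULift.{u} ℚ) G (ULift.{u} ℚ)) 1

/-- The pullback `f^* : H¹(H; ℚ) → H¹(G; ℚ)` along a homomorphism `f : G → H`. -/
noncomputable def rationalH1Pullback {G H : Type u} [Group G] [Group H] (f : G →* H) :
    rationalH1 H →ₗ[ULift.{u} ℚ] rationalH1 G :=
  (groupCohomology.map (A := Rep.trivial (ULift.{u} ℚ) H (ULift.{u} ℚ))
    (B := Rep.trivial (ULift.{u} ℚ) G (ULift.{u} ℚ)) f
    (CategoryTheory.CategoryStruct.id (Rep.trivial (ULift.{u} ℚ) G (ULift.{u} ℚ))) 1).hom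

/-!
The intersections of `Γ` with the factors generate a normal subgroup `splitPart Γ` of finite index
in `Γ`, the direct product of these intersections. Both parts compare a homomorphism on `Γ` with its
restriction to `splitPart Γ`.

For the first part, `H¹` with trivial rational coefficients is a space of homomorphisms to `ℚ`. The
restriction of such a homomorphism to one factor of `splitPart Γ`, extended by zero on the others, is
invariant under conjugation by `Γ`, so its transfer divided by the index extends it to `Γ`
(`MonoidHom.exists_extension_of_conj_invariant`). The extension kills the kernel of the projection,
because a power of every element of this kernel lies in the other factors; and homomorphisms to `ℚ`
that agree on a subgroup of finite index are equal.

For the second part, the one fact needed about a torsion-free hyperbolic group is that centralizers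
of nontrivial elements are cyclic (`IsHyperbolicGroup.isCyclic_centralizer`). Commutation is then
transitive on nontrivial elements. So either all factors of `splitPart Γ` but one die, and the
homomorphism factors through the corresponding projection, or the image of `splitPart Γ` is abelian
and the whole image lies in one centralizer.

To see that the centralizer of `c ≠ 1` is cyclic, take `h` in it that is shortest in its coset of
`⟨c⟩`. If `h` is long, the four-point condition shows that all of
`c, c ^ 2, …, c ^ N` move a point `m` in the middle of a geodesic from `1` to `h` by at most `6δ`
(`SimpleGraph.IsGromovHyperbolic.dist_le_of_parallel`); as balls are finite, this contradicts the
infinite order of `c`. So `⟨c⟩` has finite index in its centralizer, and the transfer to `⟨c⟩`, a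
power map and injective in the absence of torsion, embeds the centralizer in `⟨c⟩`.
-/

/-! ### Geodesics in hyperbolic graphs -/

namespace SimpleGraph

variable {L : Type*} [Group L]

/-- Left translations are isometries of the Cayley graph. -/
theorem mulCayley_dist_mul_left {S : Set L} (hS : (mulCayley S).Connected) (g u v : L) :
    (mulCayley S).dist (g * u) (g * v) = (mulCayley S).dist u v := by
  have key : ∀ g u v : L, (mulCayley S).dist (g * u) (g * v) ≤ (mulCayley S).dist u v := by
    intro g u v
    obtain ⟨p, hp⟩ := hS.exists_walk_length_eq_dist u v
    let f : mulCayley S →g mulCayley S := ⟨(g * ·), fun h => mulCayley_adj_mul_iff_right.2 h⟩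
    rw [← hp, ← Walk.length_map f p]
    exact dist_le _
  refine le_antisymm (key g u v) ?_
  simpa using key g⁻¹ (g * u) (g * v)

/-- The graph metric is geodesic at integer times. -/
theorem Connected.exists_dist_eq_of_le {V : Type*} {X : SimpleGraph V} (hX : X.Connected) {u v : V}
    {k : ℕ} (hk : k ≤ X.dist u v) :
    ∃ m, X.dist u m = k ∧ X.dist m v = X.dist u v - k := by
  obtain ⟨p, hp⟩ := hX.exists_walk_length_eq_dist u v
  have h1 := dist_le (p.take k)
  have h2 := dist_le (p.drop k)
  rw [Walk.take_length] at h1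
  rw [Walk.drop_length] at h2
  have h3 := hX.dist_triangle (u := u) (v := p.getVert k) (w := v)
  exact ⟨p.getVert k, by omega, by omega⟩

theorem Connected.finite_dist_le {V : Type*} {X : SimpleGraph V} (hX : X.Connected)
    (hfin : ∀ v, (X.neighborSet v).Finite) (u : V) (r : ℕ) : {v | X.dist u v ≤ r}.Finite := by
  induction r with
  | zero =>
    refine (Set.finite_singleton u).subset fun v hv => ?_
    have : X.dist u v = 0 := Nat.le_zero.1 hv
    exact (hX.dist_eq_zero_iff.1 this).symm
  | succ r ih =>
    refine (ih.union (ih.biUnion fun v _ => hfin v)).subset fun v hv => ?_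
    rcases Nat.lt_or_ge r (X.dist u v) with h | h
    · obtain ⟨m, hm, hmv⟩ := hX.exists_dist_eq_of_le h.le
      have hv' : X.dist u v ≤ r + 1 := hv
      refine Or.inr (Set.mem_biUnion (x := m) (by simp [hm]) ?_)
      exact dist_eq_one_iff_adj.1 (by omega)
    · exact Or.inl h

theorem finite_neighborSet_mulCayley {S : Set L} (hS : S.Finite) (v : L) :
    ((mulCayley S).neighborSet v).Finite := by
  refine ((hS.image (v * ·)).union (hS.image (v * ·⁻¹))).subset fun w hw => ?_
  obtain ⟨-, h | h⟩ := (mulCayley_adj S v w).1 hw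
  · exact Or.inl ⟨_, h, by simp⟩
  · exact Or.inr ⟨_, h, by simp⟩

/-- Two geodesics `[a, b]` and `[a', b']` of the same length, whose endpoints are at distance
`D = d(a, a') = d(b, b')`, are `6δ`-close at matching positions at least `D` away from the ends,
provided that neither `d(a, b')` nor `d(a', b)` is less than the length of the geodesics. That last
condition excludes that one geodesic is the other one shifted along the same line. -/
theorem IsGromovHyperbolic.dist_le_of_parallel {V : Type*} {X : SimpleGraph V} {δ : ℝ}
    (hδ : 0 < δ) (hX : X.IsGromovHyperbolic δ) {a b a' b' m m' : V} {p q D : ℕ}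
    (ham : X.dist a m = p) (hmb : X.dist m b = q) (ham' : X.dist a' m' = p)
    (hmb' : X.dist m' b' = q) (hab : X.dist a b = p + q) (hab' : X.dist a' b' = p + q)
    (haa' : X.dist a a' = D) (hbb' : X.dist b b' = D) (h₁ : p + q ≤ X.dist a b')
    (h₂ : p + q ≤ X.dist a' b) (hp : D ≤ p) (hq : D ≤ q) :
    (X.dist m m' : ℝ) ≤ 6 * δ := by
  have hp' : (D : ℝ) ≤ p := by exact_mod_cast hp
  have hq' : (D : ℝ) ≤ q := by exact_mod_cast hq
  have h₁' : (p : ℝ) + q ≤ X.dist a b' := by exact_mod_cast h₁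
  have h₂' : (p : ℝ) + q ≤ X.dist a' b := by exact_mod_cast h₂
  -- Both diagonals have length at least `p + q`, and their sum is at most `2(p + q) + 2δ`.
  have e1 : (X.dist a b' : ℝ) + X.dist a' b ≤ 2 * (p + q) + 2 * δ := by
    have := hX.2 a b' a' b
    rw [haa', X.dist_comm (u := b') (v := b), hbb', hab, X.dist_comm (u := b') (v := a'),
      hab'] at this
    push_cast at this
    have hm : max ((D : ℝ) + D) ((p : ℝ) + q + (p + q)) ≤ 2 * (p + q) :=
      max_le (by linarith) (by linarith)
    linarith
  -- One comparison bounds `d(m, a')` and, with the roles of the two ends exchanged, `d(m, b')`.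
  have dist_left : ∀ {a b a' m : V} {p q : ℕ}, X.dist a m = p → X.dist m b = q →
      X.dist a b = p + q → X.dist a a' = D → D ≤ p → (X.dist a' b : ℝ) ≤ p + q + 2 * δ →
      (X.dist m a' : ℝ) ≤ p + 4 * δ := by
    intro a b a' m p q ham hmb hab haa' hp h
    have hp' : (D : ℝ) ≤ p := by exact_mod_cast hp
    have := hX.2 m a' a b
    rw [X.dist_comm (u := m) (v := a), ham, hmb, X.dist_comm (u := a') (v := a), haa', hab] at this
    push_cast at this
    have hm : max ((p : ℝ) + X.dist a' b) (q + D) ≤ p + (p + q + 2 * δ) :=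
      max_le (by linarith) (by linarith)
    linarith
  have e2 : (X.dist m a' : ℝ) ≤ p + 4 * δ := dist_left ham hmb hab haa' hp (by linarith)
  have e3 : (X.dist m b' : ℝ) ≤ q + 4 * δ :=
    dist_left (a := b) (b := a) (a' := b') (by rw [X.dist_comm, hmb]) (by rw [X.dist_comm, ham])
      (by rw [X.dist_comm, hab, add_comm]) hbb' hq (by rw [X.dist_comm]; linarith)
  have := hX.2 m m' a' b'
  rw [X.dist_comm (u := m') (v := a'), ham', hmb', hab'] at this
  push_cast at this
  have hm : max ((X.dist m a' : ℝ) + q) ((X.dist m b' : ℝ) + p) ≤ p + q + 4 * δ :=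
    max_le (by linarith) (by linarith)
  linarith

end SimpleGraph

/-! ### Centralizers in hyperbolic groups -/

section Centralizer

open SimpleGraph

variable {L : Type*} [Group L]

/-- The elements `h` of the centralizer of `c` that are shortest in their coset of `⟨c⟩` have bounded
length. If `h` is long, the geodesics from `1` to `h` and from `c ^ j` to `c ^ j * h = h * c ^ j` run
side by side for `j = 0, …, N`, so for a point `m` in the middle of the first one the conjugates
`m⁻¹ * c ^ j * m` all lie in the ball of radius `6δ`. When `N` is the number of elements of that
ball, two of the conjugates agree, and `c` has finite order. -/
theorem exists_dist_le_of_minimal_in_zpowers_coset {S : Set L} {δ : ℝ} (hS : S.Finite) (hδ : 0 < δ)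
    (hX : (mulCayley S).IsGromovHyperbolic δ) {c : L} (hc : ¬ IsOfFinOrder c) :
    ∃ R : ℕ, ∀ h : L, Commute c h →
      (∀ k : ℤ, (mulCayley S).dist 1 h ≤ (mulCayley S).dist 1 (c ^ k * h)) →
        (mulCayley S).dist 1 h ≤ R := by
  set X := mulCayley S
  have hconn := hX.1
  have hball : {x | X.dist 1 x ≤ ⌊6 * δ⌋₊}.Finite :=
    hconn.finite_dist_le (finite_neighborSet_mulCayley hS) 1 _
  let N := hball.toFinset.card
  let D := (Finset.range (N + 1)).sup fun j => X.dist 1 (c ^ j)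
  refine ⟨2 * D, fun h hch hmin => ?_⟩
  by_contra! hlong
  obtain ⟨m, hm, hmh⟩ := hconn.exists_dist_eq_of_le (u := 1) (v := h) (k := D) (by omega)
  have hmem : ∀ j ∈ Finset.range (N + 1), m⁻¹ * c ^ j * m ∈ hball.toFinset := by
    intro j hj
    have hD : X.dist 1 (c ^ j) ≤ D := Finset.le_sup (f := fun j => X.dist 1 (c ^ j)) hj
    have hcj : c ^ j * h = h * c ^ j := (hch.pow_left j).eq
    have hinv : ∀ g u v : L, X.dist (g * u) (g * v) = X.dist u v := mulCayley_dist_mul_left hconn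
    have key : (X.dist m (c ^ j * m) : ℝ) ≤ 6 * δ := by
      refine hX.dist_le_of_parallel hδ (a := 1) (b := h) (a' := c ^ j) (b' := c ^ j * h)
        (p := D) (q := X.dist 1 h - D) (D := X.dist 1 (c ^ j)) hm hmh ?_ ?_ (by omega) ?_ rfl ?_
        ?_ ?_ hD (by omega)
      · simpa [hm] using hinv (c ^ j) 1 m
      · rw [hinv, hmh]
      · have := hinv (c ^ j) 1 h
        rw [mul_one] at this
        omega
      · have := hinv h 1 (c ^ j)
        rw [mul_one] at this
        rw [hcj, this]
      -- Minimality of `h`, for `c ^ j` and for `c ^ (-j)`, says that the diagonals are not short.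
      · have := hmin j
        rw [zpow_natCast] at this
        omega
      · have h1 := hmin (-j)
        have h2 := hinv (c ^ j) 1 (c ^ (-(j : ℤ)) * h)
        rw [mul_one, zpow_neg, zpow_natCast, mul_inv_cancel_left] at h2
        rw [zpow_neg, zpow_natCast] at h1
        omega
    have h3 := hinv m 1 (m⁻¹ * c ^ j * m)
    rw [mul_one, mul_assoc, mul_inv_cancel_left] at h3
    rw [Set.Finite.mem_toFinset, Set.mem_ofPred_eq, mul_assoc, ← h3]
    exact Nat.le_floor key
  obtain ⟨i, -, j, -, hij, heq⟩ := Finset.exists_ne_map_eq_of_card_lt_of_maps_to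
    (by simp [N]) hmem
  refine hij (injective_pow_iff_not_isOfFinOrder.2 hc ?_)
  simpa using heq

/-- In a hyperbolic group an element of infinite order generates a finite-index subgroup of its
centralizer. -/
theorem IsHyperbolicGroup.finiteIndex_zpowers_centralizer (hL : IsHyperbolicGroup L) {c : L}
    (hc : ¬ IsOfFinOrder c) :
    ((Subgroup.zpowers c).subgroupOf (Subgroup.centralizer {c})).FiniteIndex := by
  obtain ⟨S, hS, -, δ, hδ, hX⟩ := hL
  obtain ⟨R, hR⟩ := exists_dist_le_of_minimal_in_zpowers_coset hS hδ hX hc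
  have hball := hX.1.finite_dist_le (finite_neighborSet_mulCayley hS) 1 R
  set C := Subgroup.centralizer {c}
  set Z := (Subgroup.zpowers c).subgroupOf C
  have hC : ∀ h ∈ C, Commute c h := fun h hh => (Subgroup.mem_centralizer_singleton_iff.1 hh).symm
  have hfin : {h : C | (mulCayley S).dist 1 (h : L) ≤ R}.Finite :=
    hball.preimage Subtype.val_injective.injOn
  have : Finite (C ⧸ Z) := by
    refine Set.finite_univ_iff.1 ((hfin.image (QuotientGroup.mk (s := Z))).subset fun x _ => ?_)
    induction x using QuotientGroup.induction_on with
    | H h =>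
    -- Every coset has a shortest representative `c ^ k * h`, and there are finitely many of these.
    let len : ℤ → ℕ := fun k => (mulCayley S).dist 1 (c ^ k * (h : L))
    let k := Function.argmin len
    have hk : ∀ l, len k ≤ len l := fun l => Function.argmin_le len l
    have hcC : c ^ k ∈ C := C.zpow_mem (Subgroup.mem_centralizer_singleton_iff.2 rfl) k
    refine ⟨⟨c ^ k, hcC⟩ * h, ?_, ?_⟩
    · refine hR _ (hC _ (Subgroup.mul_mem _ hcC h.2)) fun l => ?_
      have := hk (l + k)
      simp only [len, zpow_add, mul_assoc] at this
      exact this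
    · refine QuotientGroup.eq.2 ⟨-k, ?_⟩
      have := ((hC h h.2).zpow_left (-k)).eq
      simpa [mul_assoc, eq_inv_mul_iff_mul_eq] using this.symm
  exact Subgroup.finiteIndex_of_finite_quotient

/-- The transfer into a central subgroup of finite index `k` is `g ↦ g ^ k`; without torsion it is
injective, and embeds the group into that subgroup. -/
theorem isCyclic_of_finiteIndex_central {C : Type*} [Group C] (hC : HasNoTorsion C)
    (Z : Subgroup C) [Z.FiniteIndex] [IsCyclic Z] (hZ : Z ≤ Subgroup.center C) : IsCyclic C := by
  let _ : CommGroup Z := IsCyclic.commGroup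
  have key : ∀ g (k : ℕ) (g₀ : C), g₀⁻¹ * g ^ k * g₀ ∈ Z → g₀⁻¹ * g ^ k * g₀ = g ^ k := by
    intro g k g₀ h
    have := Subgroup.mem_center_iff.1 (hZ h) g₀
    rw [← mul_right_cancel_iff (a := g₀), ← this]
    simp [mul_assoc]
  refine isCyclic_of_injective (MonoidHom.transfer (MonoidHom.id Z)) ?_
  rw [injective_iff_map_eq_one]
  intro g hg
  rw [MonoidHom.transfer_eq_pow _ g (key g)] at hg
  by_contra hne
  exact hC g hne (isOfFinOrder_iff_pow_eq_one.2
    ⟨Z.index, Nat.pos_of_ne_zero Subgroup.FiniteIndex.index_ne_zero, congrArg Subtype.val hg⟩)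

theorem IsHyperbolicGroup.isCyclic_centralizer (hL : IsHyperbolicGroup L) (ht : HasNoTorsion L)
    {c : L} (hc : c ≠ 1) : IsCyclic (Subgroup.centralizer {c}) := by
  have hfi := hL.finiteIndex_zpowers_centralizer (ht c hc)
  have hle : Subgroup.zpowers c ≤ Subgroup.centralizer {c} := by
    rw [Subgroup.zpowers_le]
    exact Subgroup.mem_centralizer_singleton_iff.2 rfl
  have : IsCyclic ((Subgroup.zpowers c).subgroupOf (Subgroup.centralizer {c})) :=
    isCyclic_of_injective (Subgroup.subgroupOfEquivOfLe hle).toMonoidHom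
      (Subgroup.subgroupOfEquivOfLe hle).injective
  refine isCyclic_of_finiteIndex_central (fun g hg hfin => ?_)
    ((Subgroup.zpowers c).subgroupOf (Subgroup.centralizer {c})) ?_
  · exact ht g (by simpa using hg) ((Subgroup.subtype _).isOfFinOrder hfin)
  · rintro ⟨_, hx⟩ ⟨k, rfl⟩
    refine Subgroup.mem_center_iff.2 fun g => Subtype.ext ?_
    exact (Commute.zpow_right (Subgroup.mem_centralizer_singleton_iff.1 g.2) k).eq

end Centralizer

/-! ### Extending homomorphisms by transfer -/

section Transfer

variable {Γ : Type*} [Group Γ]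

/-- Restricted to a normal subgroup `N`, the transfer of a conjugation-invariant homomorphism `h` is
`h` raised to the index: `N` acts trivially on `Γ ⧸ N`, so every coset contributes a conjugate. -/
theorem MonoidHom.transfer_eq_pow_of_conj_invariant {A : Type*} [CommGroup A] {N : Subgroup Γ}
    [hN : N.Normal] [N.FiniteIndex] (h : N →* A)
    (hinv : ∀ (g : Γ) (x : N), h ⟨g * x * g⁻¹, hN.conj_mem x x.2 g⟩ = h x) (x : N) :
    h.transfer (x : Γ) = h x ^ N.index := by
  classical
  let _ := N.fintypeQuotientOfFiniteIndex
  let T : N.LeftTransversal := default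
  rw [MonoidHom.transfer_def h T, Subgroup.leftTransversals.diff, Subgroup.index,
    Nat.card_eq_fintype_card, ← Finset.card_univ, ← Finset.prod_const]
  refine Finset.prod_congr rfl fun q _ => ?_
  have hq : (x : Γ)⁻¹ • q = q := by
    induction q using QuotientGroup.induction_on with
    | H g =>
      refine QuotientGroup.eq.2 ?_
      simpa [mul_assoc] using hN.conj_mem x x.2 g⁻¹
  rw [← hinv (T.2.leftQuotientEquiv q : Γ)⁻¹ x]
  congr 2
  rw [Subgroup.smul_apply_eq_smul_apply_inv_smul, hq]
  simp [mul_assoc]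

/-- A conjugation-invariant homomorphism from a normal subgroup of finite index to a rational vector
space extends to the whole group: its transfer divided by the index is an extension. -/
theorem MonoidHom.exists_extension_of_conj_invariant {V : Type*} [AddCommGroup V] [Module ℚ V]
    {N : Subgroup Γ} [hN : N.Normal] [N.FiniteIndex] (h : N →* Multiplicative V)
    (hinv : ∀ (g : Γ) (x : N), h ⟨g * x * g⁻¹, hN.conj_mem x x.2 g⟩ = h x) :
    ∃ F : Γ →* Multiplicative V, ∀ x : N, F x = h x := by
  let s : V →+ V := DistribSMul.toAddMonoidHom V (N.index : ℚ)⁻¹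
  refine ⟨(AddMonoidHom.toMultiplicative s).comp h.transfer, fun x => ?_⟩
  have hne : (N.index : ℚ) ≠ 0 := by exact_mod_cast Subgroup.FiniteIndex.index_ne_zero
  rw [MonoidHom.comp_apply, MonoidHom.transfer_eq_pow_of_conj_invariant h hinv]
  change Multiplicative.ofAdd ((N.index : ℚ)⁻¹ • (N.index • (h x).toAdd)) = h x
  rw [← Nat.cast_smul_eq_nsmul ℚ, smul_smul, inv_mul_cancel₀ hne, one_smul, ofAdd_toAdd]

theorem MonoidHom.map_eq_one_of_pow {V : Type*} [Group V] (hV : HasNoTorsion V) (f : Γ →* V)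
    {g : Γ} {k : ℕ} (hk : 0 < k) (h : f (g ^ k) = 1) : f g = 1 := by
  by_contra hne
  exact hV _ hne (isOfFinOrder_iff_pow_eq_one.2 ⟨k, hk, by rw [← map_pow, h]⟩)

theorem MonoidHom.eq_of_eqOn_finiteIndex {V : Type*} [CommGroup V] (hV : HasNoTorsion V)
    (N : Subgroup Γ) [N.FiniteIndex] {f f' : Γ →* V} (h : ∀ x ∈ N, f x = f' x) : f = f' := by
  ext g
  obtain ⟨k, hk, -, hmem⟩ :=
    Subgroup.exists_pow_mem_of_index_ne_zero (H := N) Subgroup.FiniteIndex.index_ne_zero g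
  have : (f / f') g = 1 := (f / f').map_eq_one_of_pow hV hk (by simp [h _ hmem])
  simpa [div_eq_one] using this

theorem hasNoTorsion_multiplicative (V : Type*) [AddCommGroup V] [Module ℚ V] :
    HasNoTorsion (Multiplicative V) := by
  intro g hg hfin
  obtain ⟨k, hk, hgk⟩ := isOfFinOrder_iff_pow_eq_one.1 hfin
  have h : k • g.toAdd = 0 := congrArg Multiplicative.toAdd hgk
  rw [← Nat.cast_smul_eq_nsmul ℚ, smul_eq_zero] at h
  rcases h with h | h
  · exact hk.ne' (by exact_mod_cast h)
  · exact hg h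

end Transfer

/-! ### The product of the intersections with the factors -/

section SplitPart

variable {n : ℕ} {G : Fin n → Type u} [∀ i, Group (G i)] (Γ : Subgroup (∀ i, G i))

/-- The subgroup of `Γ` that is the direct product of the intersections of `Γ` with the factors:
its elements are those all of whose coordinates, viewed in the product, lie in `Γ`. -/
def splitPart : Subgroup Γ where
  carrier := {x | ∀ i, Pi.mulSingle i ((x : ∀ i, G i) i) ∈ Γ}
  one_mem' i := by simp
  mul_mem' {x y} hx hy i := by
    simpa [Pi.mulSingle_mul] using Γ.mul_mem (hx i) (hy i)
  inv_mem' {x} hx i := by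
    simpa [Pi.mulSingle_inv] using Γ.inv_mem (hx i)

/-- The `i`th coordinate of an element of `splitPart Γ`, viewed as an element of `Γ`. -/
def splitCoord (i : Fin n) : splitPart Γ →* Γ where
  toFun x := ⟨Pi.mulSingle i (((x : Γ) : ∀ i, G i) i), x.2 i⟩
  map_one' := by ext1; simp
  map_mul' x y := by ext1; simp [Pi.mulSingle_mul]

theorem mulSingle_conj (g x : ∀ i, G i) (i : Fin n) :
    Pi.mulSingle i ((g * x * g⁻¹) i) = g * Pi.mulSingle i (x i) * g⁻¹ := by
  ext j
  rcases eq_or_ne j i with rfl | hj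
  · simp
  · simp [hj]

instance splitPart_normal : (splitPart Γ).Normal where
  conj_mem x hx g i := by
    have := Γ.mul_mem (Γ.mul_mem g.2 (hx i)) (Γ.inv_mem g.2)
    rw [← mulSingle_conj] at this
    exact this

instance splitPart_finiteIndex [Γ.FiniteIndex] : (splitPart Γ).FiniteIndex := by
  have hcomap : ∀ {A B : Type u} [Group A] [Group B] (f : A →* B) {H : Subgroup B},
      H.FiniteIndex → (H.comap f).FiniteIndex := fun f H _ =>
    ⟨by rw [Subgroup.index_comap]; exact Subgroup.FiniteIndex.index_ne_zero (H := H.subgroupOf _)⟩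
  let N : Subgroup (∀ i, G i) :=
    ⨅ i, (Γ.comap (MonoidHom.mulSingle G i)).comap (Pi.evalMonoidHom G i)
  have : N.FiniteIndex := Subgroup.finiteIndex_iInf fun i => hcomap _ (hcomap _ ‹_›)
  refine Subgroup.finiteIndex_of_le (H := N.subgroupOf Γ) fun x hx i => ?_
  exact Subgroup.mem_iInf.1 hx i

variable {Γ}

theorem splitCoord_conj (i : Fin n) (g : Γ) (x : splitPart Γ) :
    splitCoord Γ i ⟨g * x * g⁻¹, (splitPart_normal Γ).conj_mem x x.2 g⟩ =
      g * splitCoord Γ i x * g⁻¹ :=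
  Subtype.ext (mulSingle_conj (g : ∀ i, G i) ((x : Γ) : ∀ i, G i) i)

theorem splitCoord_mem (i : Fin n) (x : splitPart Γ) : splitCoord Γ i x ∈ splitPart Γ := by
  intro j
  change Pi.mulSingle j ((Pi.mulSingle i (((x : Γ) : ∀ i, G i) i) : ∀ i, G i) j) ∈ Γ
  rcases eq_or_ne j i with rfl | hj
  · simpa using x.2 j
  · simp [hj]

theorem splitCoord_splitCoord_self (i : Fin n) (x : splitPart Γ) :
    splitCoord Γ i ⟨splitCoord Γ i x, splitCoord_mem i x⟩ = splitCoord Γ i x := by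
  ext1
  simp [splitCoord]

theorem splitCoord_splitCoord_of_ne {i j : Fin n} (h : i ≠ j) (x : splitPart Γ) :
    splitCoord Γ i ⟨splitCoord Γ j x, splitCoord_mem j x⟩ = 1 := by
  ext1
  simp [splitCoord, h]

theorem splitCoord_eq_one {i : Fin n} {x : splitPart Γ} (h : subProj Γ i x = 1) :
    splitCoord Γ i x = 1 := by
  have h' : ((x : Γ) : ∀ i, G i) i = 1 := h
  ext1
  simp [splitCoord, h']

theorem subProj_splitCoord_self (i : Fin n) (x : splitPart Γ) :
    subProj Γ i (splitCoord Γ i x) = subProj Γ i x := by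
  simp [splitCoord, subProj]

theorem subProj_splitCoord_of_ne {i j : Fin n} (h : i ≠ j) (x : splitPart Γ) :
    subProj Γ i (splitCoord Γ j x) = 1 := by
  simp [splitCoord, subProj, h]

theorem commute_splitCoord {i j : Fin n} (h : i ≠ j) (x y : splitPart Γ) :
    Commute (splitCoord Γ i x) (splitCoord Γ j y) :=
  Subtype.ext (Pi.mulSingle_commute h _ _).eq

/-- An element of `splitPart Γ` is the product of its coordinates. -/
theorem mem_of_splitCoord_mem {K : Subgroup Γ} (x : splitPart Γ)
    (h : ∀ i, splitCoord Γ i x ∈ K) : (x : Γ) ∈ K := by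
  have : ((x : Γ) : ∀ i, G i) ∈ K.map Γ.subtype :=
    Subgroup.pi_mem_of_mulSingle_mem _ fun i => ⟨_, h i, rfl⟩
  obtain ⟨y, hy, hyx⟩ := this
  rwa [← Subtype.ext hyx]

theorem exists_pow_mem_splitPart [Γ.FiniteIndex] (g : Γ) : ∃ k, 0 < k ∧ g ^ k ∈ splitPart Γ := by
  obtain ⟨k, hk, -, hmem⟩ := Subgroup.exists_pow_mem_of_index_ne_zero (H := splitPart Γ)
    Subgroup.FiniteIndex.index_ne_zero g
  exact ⟨k, hk, hmem⟩

/-! ### Homomorphisms on a subgroup of a product -/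

/-- A homomorphism from `Γ` to a group without torsion factors through the `i`th projection as soon
as it kills all the other factors of `splitPart Γ`. -/
theorem exists_eq_comp_subProj [Γ.FiniteIndex] {A : Type*} [Group A] (hA : HasNoTorsion A)
    (f : Γ →* A) (i : Fin n) (h : ∀ j ≠ i, ∀ x, f (splitCoord Γ j x) = 1) :
    ∃ ψ : (subProj Γ i).range →* A, f = ψ.comp (subProj Γ i).rangeRestrict := by
  have hker : (subProj Γ i).rangeRestrict.ker ≤ f.ker := by
    intro g hg
    rw [MonoidHom.ker_rangeRestrict, MonoidHom.mem_ker] at hg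
    obtain ⟨k, hk, hmem⟩ := exists_pow_mem_splitPart g
    refine f.map_eq_one_of_pow hA hk (mem_of_splitCoord_mem (K := f.ker) ⟨_, hmem⟩ fun j => ?_)
    rcases eq_or_ne j i with rfl | hj
    · rw [splitCoord_eq_one (by simp [hg])]
      exact Subgroup.one_mem _
    · exact h j hj _
  exact ⟨(subProj Γ i).rangeRestrict.liftOfSurjective (MonoidHom.rangeRestrict_surjective _)
    ⟨f, hker⟩, (MonoidHom.liftOfRightInverse_comp _ _ _ ⟨f, hker⟩).symm⟩

/-- Every homomorphism `f` from `Γ` to a rational vector space is a sum of homomorphisms that factor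
through the projections. The `i`th summand extends the restriction of `f` to the `i`th factor of
`splitPart Γ`, which is invariant under conjugation by `Γ`. -/
theorem exists_eq_prod_comp_subProj [Γ.FiniteIndex] {V : Type*} [AddCommGroup V] [Module ℚ V]
    (f : Γ →* Multiplicative V) :
    ∃ F : ∀ i, (subProj Γ i).range →* Multiplicative V,
      f = ∏ i, (F i).comp (subProj Γ i).rangeRestrict := by
  have hV := hasNoTorsion_multiplicative V
  have hext : ∀ i, ∃ F : (subProj Γ i).range →* Multiplicative V,
      ∀ x, F ((subProj Γ i).rangeRestrict (x : splitPart Γ)) = f (splitCoord Γ i x) := by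
    intro i
    obtain ⟨F', hF'⟩ := MonoidHom.exists_extension_of_conj_invariant (f.comp (splitCoord Γ i))
      fun g x => by simp [splitCoord_conj, mul_comm (f g)]
    obtain ⟨F, hF⟩ := exists_eq_comp_subProj hV F' i fun j hj x => by
      rw [hF' ⟨_, splitCoord_mem j x⟩, MonoidHom.comp_apply, splitCoord_splitCoord_of_ne hj.symm,
        map_one]
    exact ⟨F, fun x => by rw [← MonoidHom.comp_apply, ← hF, hF', MonoidHom.comp_apply]⟩
  choose F hF using hext
  refine ⟨F, MonoidHom.eq_of_eqOn_finiteIndex hV (splitPart Γ) fun x hx => ?_⟩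
  refine mem_of_splitCoord_mem
    (K := f.eqLocus (∏ i, (F i).comp (subProj Γ i).rangeRestrict)) ⟨x, hx⟩ fun i => ?_
  change f _ = (∏ i, (F i).comp (subProj Γ i).rangeRestrict) _
  rw [MonoidHom.finsetProd_apply, Finset.prod_eq_single i]
  · rw [MonoidHom.comp_apply, hF i ⟨_, splitCoord_mem i _⟩, splitCoord_splitCoord_self]
  · intro j _ hj
    rw [MonoidHom.comp_apply, hF j ⟨_, splitCoord_mem i _⟩, splitCoord_splitCoord_of_ne hj, map_one]
  · simp

/-- The decomposition of a homomorphism into homomorphisms that factor through the projections is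
unique: on the `i`th factor of `splitPart Γ` only the `i`th one is nontrivial. -/
theorem eq_one_of_prod_comp_subProj_eq_one [Γ.FiniteIndex] {A : Type*} [CommGroup A]
    (hA : HasNoTorsion A) (F : ∀ i, (subProj Γ i).range →* A)
    (h : ∏ i, (F i).comp (subProj Γ i).rangeRestrict = 1) (i : Fin n) : F i = 1 := by
  have hcomp : (F i).comp (subProj Γ i).rangeRestrict = 1 := by
    refine MonoidHom.eq_of_eqOn_finiteIndex hA (splitPart Γ) fun x hx => ?_
    have := DFunLike.congr_fun h (splitCoord Γ i ⟨x, hx⟩)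
    rw [MonoidHom.finsetProd_apply, Finset.prod_eq_single i] at this
    · rw [MonoidHom.one_apply] at this ⊢
      rw [← this, MonoidHom.comp_apply, MonoidHom.comp_apply]
      congr 1
      exact Subtype.ext (subProj_splitCoord_self i ⟨x, hx⟩).symm
    · intro j _ hj
      rw [MonoidHom.comp_apply, ← map_one (F j)]
      congr 1
      exact Subtype.ext (subProj_splitCoord_of_ne hj ⟨x, hx⟩)
    · simp
  exact (MonoidHom.cancel_right (MonoidHom.rangeRestrict_surjective _)).1 (by rw [hcomp]; rfl)

/-- If the centralizers of nontrivial elements of a group `L` without torsion are cyclic, then a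
homomorphism from `Γ` to `L` that does not factor through a projection has cyclic image. Beside
each factor of `splitPart Γ` there is then another one with nontrivial image, so the image of each
factor commutes with a nontrivial element. Hence `splitPart Γ` has abelian image, and the whole
image centralizes any nontrivial element of it. -/
theorem factors_or_isCyclic_range [Γ.FiniteIndex] {L : Type*} [Group L] (ht : HasNoTorsion L)
    (hcent : ∀ c : L, c ≠ 1 → IsCyclic (Subgroup.centralizer {c})) (φ : Γ →* L) :
    (∃ (i : Fin n) (ψ : (subProj Γ i).range →* L), φ = ψ.comp (subProj Γ i).rangeRestrict) ∨
      IsCyclic φ.range := by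
  -- Commutation is transitive on nontrivial elements.
  have hcomm : ∀ c : L, c ≠ 1 → ∀ a b : L, Commute a c → Commute b c → Commute a b := by
    intro c hc a b ha hb
    have := hcent c hc
    have hmem : ∀ {x}, Commute x c → x ∈ Subgroup.centralizer {c} :=
      fun hx => Subgroup.mem_centralizer_singleton_iff.2 hx
    have := IsCyclic.isMulCommutative (α := Subgroup.centralizer {c})
    exact congrArg Subtype.val
      (this.is_comm.comm (⟨a, hmem ha⟩ : Subgroup.centralizer {c}) ⟨b, hmem hb⟩)
  by_cases hfac : ∃ i, ∀ j ≠ i, ∀ x, φ (splitCoord Γ j x) = 1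
  · obtain ⟨i, hi⟩ := hfac
    obtain ⟨ψ, hψ⟩ := exists_eq_comp_subProj ht φ i hi
    exact Or.inl ⟨i, ψ, hψ⟩
  right
  by_cases htriv : ∀ g, φ g = 1
  · have : φ.range = ⊥ := by
      rw [MonoidHom.range_eq_bot_iff]
      ext g
      exact htriv g
    rw [this]
    infer_instance
  push Not at hfac htriv
  -- For `i = j`, both elements commute with a nontrivial element of the image of another factor.
  have hsplit : ∀ i j x y, Commute (φ (splitCoord Γ i x)) (φ (splitCoord Γ j y)) := by
    intro i j x y
    rcases eq_or_ne i j with rfl | hij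
    · obtain ⟨k, hk, z, hz⟩ := hfac i
      exact hcomm _ hz _ _ ((commute_splitCoord hk.symm x z).map φ)
        ((commute_splitCoord hk.symm y z).map φ)
    · exact (commute_splitCoord hij x y).map φ
  have hab : ∀ x ∈ splitPart Γ, ∀ y ∈ splitPart Γ, Commute (φ x) (φ y) := by
    intro x hx y hy
    have h1 : ∀ j, φ x ∈ Subgroup.centralizer {φ (splitCoord Γ j ⟨y, hy⟩)} := fun j =>
      mem_of_splitCoord_mem (K := (Subgroup.centralizer _).comap φ) ⟨x, hx⟩ fun i =>
        Subgroup.mem_centralizer_singleton_iff.2 (hsplit i j _ _)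
    have h2 := mem_of_splitCoord_mem (K := (Subgroup.centralizer {φ x}).comap φ) ⟨y, hy⟩ fun j =>
      Subgroup.mem_centralizer_singleton_iff.2
        (Subgroup.mem_centralizer_singleton_iff.1 (h1 j)).symm
    exact (Subgroup.mem_centralizer_singleton_iff.1 h2).symm
  have hpow : ∀ g, φ g ≠ 1 → ∃ k, g ^ k ∈ splitPart Γ ∧ φ (g ^ k) ≠ 1 := by
    intro g hg
    obtain ⟨k, hk, hmem⟩ := exists_pow_mem_splitPart g
    exact ⟨k, hmem, fun h => hg (φ.map_eq_one_of_pow ht hk h)⟩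
  obtain ⟨g₀, hg₀⟩ := htriv
  obtain ⟨k₀, hmem₀, hne₀⟩ := hpow g₀ hg₀
  have := hcent _ hne₀
  have hle : φ.range ≤ Subgroup.centralizer {φ (g₀ ^ k₀)} := by
    rintro _ ⟨g, rfl⟩
    rw [Subgroup.mem_centralizer_singleton_iff]
    by_cases hg : φ g = 1
    · simp [hg]
    obtain ⟨k, hmem, hne⟩ := hpow g hg
    -- `φ g` and `φ (g₀ ^ k₀)` both commute with the power `φ (g ^ k) ≠ 1`.
    refine hcomm _ hne _ _ ?_ (hab _ hmem₀ _ hmem)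
    rw [map_pow]
    exact (Commute.refl _).pow_right k
  exact isCyclic_of_injective (Subgroup.inclusion hle) (Subgroup.inclusion_injective hle)

end SplitPart

/-! ### First cohomology -/

section Cohomology

open groupCohomology

/-- `H¹(G; ℚ)` is the group of homomorphisms from `G` to `ℚ`, the coefficients being trivial. The
homomorphisms are written multiplicatively, to suit the transfer and products of homomorphisms. -/
noncomputable def rationalH1Equiv (G : Type u) [Group G] :
    rationalH1 G ≃+ Additive (G →* Multiplicative (ULift.{u} ℚ)) :=
  AddEquiv.trans
    (H1IsoOfIsTrivial (Rep.trivial (ULift.{u} ℚ) G (ULift.{u} ℚ))).toLinearEquiv.toAddEquiv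
    AddMonoidHom.toMultiplicativeRightAddEquiv

theorem rationalH1Equiv_pullback {G H : Type u} [Group G] [Group H] (f : G →* H)
    (x : rationalH1 H) :
    rationalH1Equiv G (rationalH1Pullback f x) =
      Additive.ofMul ((rationalH1Equiv H x).toMul.comp f) := by
  induction x using H1_induction_on with
  | h c =>
  have h := H1π_comp_map_apply (A := Rep.trivial (ULift.{u} ℚ) H (ULift.{u} ℚ))
    (B := Rep.trivial (ULift.{u} ℚ) G (ULift.{u} ℚ)) f
    (CategoryTheory.CategoryStruct.id (Rep.trivial (ULift.{u} ℚ) G (ULift.{u} ℚ))) c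
  refine congrArg Additive.ofMul (MonoidHom.ext fun g => congrArg Multiplicative.ofAdd ?_)
  refine (congrArg (fun y => (H1IsoOfIsTrivial (Rep.trivial (ULift.{u} ℚ) G (ULift.{u} ℚ))).hom y
    (Additive.ofMul g)) h).trans ?_
  refine (H1IsoOfIsTrivial_H1π_apply_apply _ _).trans ?_
  exact (H1IsoOfIsTrivial_H1π_apply_apply c (Additive.ofMul (f g))).symm

/-- The ranges of the maps `T i` are the summands of an internal direct sum when every element is a
sum of values of the `T i` in exactly one way. -/
theorem DirectSum.isInternal_range_of_sum {R ι : Type*} [Ring R] [Fintype ι] [DecidableEq ι]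
    {M : ι → Type*} {N : Type*} [∀ i, AddCommGroup (M i)] [∀ i, Module R (M i)] [AddCommGroup N]
    [Module R N] (T : ∀ i, M i →ₗ[R] N) (hsurj : ∀ y, ∃ m : ∀ i, M i, ∑ i, T i (m i) = y)
    (hinj : ∀ m : ∀ i, M i, ∑ i, T i (m i) = 0 → ∀ i, m i = 0) :
    DirectSum.IsInternal fun i => LinearMap.range (T i) := by
  have hcoe : ∀ d : DirectSum ι fun i => LinearMap.range (T i),
      DirectSum.coeAddMonoidHom (fun i => LinearMap.range (T i)) d = ∑ i, (d i : N) := by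
    classical
    intro d
    rw [DirectSum.coeAddMonoidHom_eq_dfinsuppSum]
    exact DFinsupp.sum_eq_sum_fintype _ (fun i => rfl)
  refine ⟨(injective_iff_map_eq_zero _).2 fun d hd => ?_, fun y => ?_⟩
  · rw [hcoe] at hd
    choose m hm using fun i => (d i).2
    have := hinj m (by simpa only [hm] using hd)
    refine DFinsupp.ext fun i => Subtype.ext ?_
    rw [← hm, this i, map_zero]
    rfl
  · obtain ⟨m, rfl⟩ := hsurj y
    refine ⟨DFinsupp.equivFunOnFintype.symm fun i => ⟨T i (m i), m i, rfl⟩, ?_⟩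
    rw [hcoe]
    rfl

theorem isInternal_range_rationalH1Pullback {n : ℕ} {G : Fin n → Type u} [∀ i, Group (G i)]
    (Γ : Subgroup (∀ i, G i)) [Γ.FiniteIndex] :
    DirectSum.IsInternal
      (fun i : Fin n => LinearMap.range (rationalH1Pullback (subProj Γ i).rangeRestrict)) := by
  have hsum : ∀ x : ∀ i, rationalH1 (subProj Γ i).range,
      rationalH1Equiv Γ (∑ i, rationalH1Pullback (subProj Γ i).rangeRestrict (x i)) =
        Additive.ofMul (∏ i, (rationalH1Equiv _ (x i)).toMul.comp
          (subProj Γ i).rangeRestrict) := by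
    intro x
    rw [map_sum, ofMul_prod]
    exact Finset.sum_congr rfl fun i _ => rationalH1Equiv_pullback _ _
  refine DirectSum.isInternal_range_of_sum _ (fun y => ?_) (fun x hx i => ?_)
  · obtain ⟨F, hF⟩ := exists_eq_prod_comp_subProj (rationalH1Equiv Γ y).toMul
    refine ⟨fun i => (rationalH1Equiv _).symm (Additive.ofMul (F i)),
      (rationalH1Equiv Γ).injective ?_⟩
    rw [hsum]
    simp only [AddEquiv.apply_symm_apply, toMul_ofMul]
    rw [← hF, ofMul_toMul]
  · have h := hsum x
    rw [hx, map_zero] at h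
    have := eq_one_of_prod_comp_subProj_eq_one (hasNoTorsion_multiplicative _) _ h.symm i
    exact (rationalH1Equiv _).map_eq_zero_iff.1 this

end Cohomology

theorem theorem2 {n : ℕ} (G : Fin n → Type u) [∀ i, Group (G i)]
    (Γ : Subgroup (∀ i, G i)) [Γ.FiniteIndex] :
    DirectSum.IsInternal
      (fun i : Fin n => LinearMap.range (rationalH1Pullback (subProj Γ i).rangeRestrict)) ∧
    ∀ (L : Type v) [Group L], IsHyperbolicGroup L → HasNoTorsion L → ¬ IsElementaryGroup L →
      ∀ φ : Γ →* L,
        (∃ (i : Fin n) (ψ : (subProj Γ i).range →* L),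
          φ = ψ.comp (subProj Γ i).rangeRestrict) ∨
        IsCyclic φ.range :=
  ⟨isInternal_range_rationalH1Pullback Γ, fun _ _ hL ht _ φ =>
    factors_or_isCyclic_range ht (fun _ hc => hL.isCyclic_centralizer ht hc) φ⟩
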